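/- Let $\mathcal D$ be a fixed probability distribution on $\mathbb R$ that is continuous (no atoms) and has finite mean, $\mathbb E|V|<\infty$ for $V\sim\mathcal D$. For every $p\in\mathbb Z_{>0}$ let $n=n_p\in\mathbb Z_{>0}$, $Q=Q_p\in\mathbb Z_{>0}$, $R=R_p>0$ and $\sigma=\sigma_p$ be real parameters, depending on $p$ in an arbitrary way, such that $QR$ is an integer and $$\sigma > R\,(np)^3\left(2^{\frac{2p\log_2(2QR+1)}{n}}-1\right)^{-1/2}.$$ Let $X\in\mathbb R^{n\times p}$ have iid entries with law $\mathcal D$, and let $W\in\mathbb R^n$ be independent of $X$ with iid $N(0,\sigma^2)$ entries. Call $\beta\in\mathbb R^p$ admissible if $\beta\in[-R,R]^p$ and every entry of $\beta$ is of the form $K/Q$ with $K\in\mathbb Z$; for an admissible $\beta^*$ one observes $Y=X\beta^*+W$. Then there is no mechanism which, with knowledge of $Y,X,Q,R,\sigma$, recovers every admissible $\beta^*$ exactly with probability tending to $1$ as $p\to\infty$. That is, for every estimator $\hat\beta=\hat\beta(Y,X,Q,R,\sigma)$ (for each $n$, $p$, $Q$, $R$, $\sigma$, a measurable function of $(Y,X)$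 with values in $\mathbb R^p$) there are admissible vectors $\beta^*=\beta^*_p\in\mathbb R^p$, $p\ge 1$, such that $$\limsup_{p\to\infty}\ \mathbb P\left(\hat\beta(X\beta^*+W,X,Q,R,\sigma)=\beta^*\right)<1 .$$ -/

import Mathlib

open MeasureTheory ProbabilityTheory Filter
open scoped Matrix

/-- The product (equivalently Borel) σ-algebra on real matrices. -/
instance realMatrixMeasurableSpace (n p : ℕ) : MeasurableSpace (Matrix (Fin n) (Fin p) ℝ) :=
  inferInstanceAs (MeasurableSpace (Fin n → Fin p → ℝ))

/-- A vector `β ∈ ℝ^p` satisfies the `Q`-rationality assumption if each entry is `K / Q` for some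
integer `K`. -/
def QRational {p : ℕ} (Q : ℕ) (β : Fin p → ℝ) : Prop :=
  ∀ i, ∃ K : ℤ, β i = (K : ℝ) / (Q : ℝ)

/-- The admissible ground truth vectors: the `Q`-rational vectors in `[-R, R]^p`. -/
def admissible (p Q : ℕ) (R : ℝ) : Set (Fin p → ℝ) :=
  {β | QRational Q β ∧ ∀ i, β i ∈ Set.Icc (-R) R}

/-- The random design matrix `X` and noise vector `W` on the probability space `(Ω, μ)`:
`X` has iid entries of law `D`, `W` has iid entries of law `N(0, σ²)`, and `X`, `W` are
independent. -/
structure IsGaussianDesign {Ω : Type*} [MeasurableSpace Ω] (μ : Measure Ω) {n p : ℕ}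
    (D : Measure ℝ) (σ : ℝ) (X : Ω → Matrix (Fin n) (Fin p) ℝ) (W : Ω → Fin n → ℝ) : Prop where
  entry_law : ∀ i j, HasLaw (fun ω => X ω i j) D μ
  entry_indep : iIndepFun (fun (ij : Fin n × Fin p) ω => X ω ij.1 ij.2) μ
  noise_law : ∀ i, HasLaw (fun ω => W ω i) (gaussianReal 0 (Real.toNNReal (σ ^ 2))) μ
  noise_indep : iIndepFun (fun i ω => W ω i) μ
  indep : IndepFun X W μ

/-- A recovery mechanism: for every `n` and `p`, a function of `(Y, X, Q, R, σ)` with values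
in `ℝ^p`. -/
abbrev Estimator : Type :=
  (n p : ℕ) → (Fin n → ℝ) → Matrix (Fin n) (Fin p) ℝ → ℕ → ℝ → ℝ → (Fin p → ℝ)

/-- For all fixed parameters, the mechanism is a measurable function of the data `(Y, X)`, so that
the event of exact recovery has a probability. -/
def Estimator.IsMeasurable (est : Estimator) : Prop :=
  ∀ (n p Q : ℕ) (R σ : ℝ),
    Measurable (fun d : (Fin n → ℝ) × Matrix (Fin n) (Fin p) ℝ => est n p d.1 d.2 Q R σ)

/-- The noise threshold `R (np)³ (2^{2 p log₂(2QR+1) / n} - 1)^{-1/2}`. -/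
noncomputable def noiseThreshold (n p Q : ℕ) (R : ℝ) : ℝ :=
  R * ((n : ℝ) * (p : ℝ)) ^ 3 *
    ((2 : ℝ) ^ (2 * (p : ℝ) * Real.logb 2 (2 * (Q : ℝ) * R + 1) / (n : ℝ)) - 1) ^ (-(1 / 2) : ℝ)

/-! This is a counting argument over the `(2k+1)^p` admissible vectors, where `k = QR`. For a fixed
design `x` the events of decoding to distinct vectors are disjoint, so the success probabilities sum
to at most the integral of the largest likelihood. If all signals lie in `[-A, A]^n`, this is at
most `(1 + A/σ)^n` (`sum_gaussian_success_le`). Markov's inequality and a union bound keep all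
entries of `X` below `npK` outside an event of probability at most `1/4`, so `A = Rp·npK` serves.
The noise threshold then makes `(1 + A/σ)^n` at most half the number of vectors
(`one_add_pow_le_half`). The average success probability is thus at most `3/4` for all large `p`,
and some vector does no better than the average. -/

open scoped ENNReal NNReal

namespace MeasureTheory.Measure

lemma pi_mono {ι : Type*} [Fintype ι] {α : ι → Type*} [∀ i, MeasurableSpace (α i)]
    {μ ν : ∀ i, Measure (α i)} (h : ∀ i, μ i ≤ ν i) : Measure.pi μ ≤ Measure.pi ν := by
  refine Measure.le_iff.2 fun s hs => ?_
  rw [Measure.pi, Measure.pi, toMeasure_apply _ _ hs, toMeasure_apply _ _ hs]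
  revert s
  suffices OuterMeasure.pi (fun i => (μ i).toOuterMeasure) ≤
      OuterMeasure.pi (fun i => (ν i).toOuterMeasure) from fun s _ => this s
  exact OuterMeasure.le_pi.2 fun s _ => (OuterMeasure.pi_pi_le _ s).trans
    (Finset.prod_le_prod' fun i _ => h i (s i))

end MeasureTheory.Measure

/-! ### Gaussian envelope and the decoding bound for a fixed design. -/

lemma gaussianPDFReal_le_of_abs_sub_le {a b x y : ℝ} {v : ℝ≥0} (h : |y - b| ≤ |x - a|) :
    gaussianPDFReal a v x ≤ gaussianPDFReal b v y := by
  unfold gaussianPDFReal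
  have := sq_le_sq.2 h
  gcongr

lemma gaussianPDF_le_of_abs_sub_le {a b x y : ℝ} {v : ℝ≥0} (h : |y - b| ≤ |x - a|) :
    gaussianPDF a v x ≤ gaussianPDF b v y :=
  ENNReal.ofReal_le_ofReal (gaussianPDFReal_le_of_abs_sub_le h)

/-- The pointwise supremum of the densities of the Gaussian laws of variance `v` whose mean lies
in `[-A, A]`. -/
noncomputable def gaussianEnvelope (A : ℝ) (v : ℝ≥0) (y : ℝ) : ℝ≥0∞ :=
  (Set.Iio (-A)).indicator (gaussianPDF (-A) v) y +
    (Set.Icc (-A) A).indicator (fun _ => gaussianPDF 0 v 0) y +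
    (Set.Ioi A).indicator (gaussianPDF A v) y

/-- The density at `y` is largest for the mean nearest to `y`: an endpoint of the interval if `y` is
outside, `y` itself otherwise. -/
lemma gaussianPDF_le_gaussianEnvelope {A c : ℝ} (hc : |c| ≤ A) (v : ℝ≥0) (y : ℝ) :
    gaussianPDF c v y ≤ gaussianEnvelope A v y := by
  obtain ⟨h1, h2⟩ := abs_le.1 hc
  unfold gaussianEnvelope
  rcases lt_or_ge y (-A) with h | h
  · rw [Set.indicator_of_mem (Set.mem_Iio.2 h), add_assoc]
    refine le_add_right (gaussianPDF_le_of_abs_sub_le ?_)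
    rw [abs_of_nonpos (by linarith), abs_of_nonpos (by linarith)]
    linarith
  · rcases le_or_gt y A with h' | h'
    · rw [Set.indicator_of_mem (s := Set.Icc (-A) A) ⟨h, h'⟩]
      refine le_add_right (le_add_left (gaussianPDF_le_of_abs_sub_le ?_))
      simp
    · rw [Set.indicator_of_mem (Set.mem_Ioi.2 h')]
      refine le_add_left (gaussianPDF_le_of_abs_sub_le ?_)
      rw [abs_of_nonneg (by linarith), abs_of_nonneg (by linarith)]
      linarith

lemma gaussianReal_le_withDensity_gaussianEnvelope {A c : ℝ} (hc : |c| ≤ A) {v : ℝ≥0}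
    (hv : v ≠ 0) : gaussianReal c v ≤ volume.withDensity (gaussianEnvelope A v) := by
  rw [gaussianReal_of_var_ne_zero _ hv]
  exact withDensity_mono (ae_of_all _ (gaussianPDF_le_gaussianEnvelope hc v))

lemma lintegral_gaussianEnvelope_le {A σ : ℝ} (hA : 0 ≤ A) (hσ : 0 < σ) :
    ∫⁻ y, gaussianEnvelope A (Real.toNNReal (σ ^ 2)) y ≤ ENNReal.ofReal (1 + A / σ) := by
  set v := Real.toNNReal (σ ^ 2) with hv
  have hv0 : v ≠ 0 := by
    rw [hv, Ne, Real.toNNReal_eq_zero, not_le]; positivity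
  have hm : ∀ c, Measurable (gaussianPDF c v) := fun c => measurable_gaussianPDF c v
  have shift (c : ℝ) (s : Set ℝ) (hs : MeasurableSet s) :
      ∫⁻ y in s, gaussianPDF c v y = gaussianReal 0 v ((· + c) ⁻¹' s) := by
    rw [← gaussianReal_apply c hv0, ← Measure.map_apply (measurable_add_const c) hs,
      gaussianReal_map_add_const, zero_add]
  -- Translated to the origin, the two tails become the disjoint half-lines of a single centred
  -- Gaussian.
  have htail : (∫⁻ y in Set.Iio (-A), gaussianPDF (-A) v y) +
      (∫⁻ y in Set.Ioi A, gaussianPDF A v y) ≤ 1 := by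
    rw [shift _ _ measurableSet_Iio, shift _ _ measurableSet_Ioi,
      ← measure_union _ (measurable_add_const A measurableSet_Ioi)]
    · exact prob_le_one
    · refine Set.disjoint_left.2 fun y h1 h2 => ?_
      simp only [Set.mem_preimage, Set.mem_Iio, Set.mem_Ioi] at h1 h2
      linarith
  have hmid : ∫⁻ _ in Set.Icc (-A) A, gaussianPDF 0 v 0 ≤ ENNReal.ofReal (A / σ) := by
    rw [setLIntegral_const, Real.volume_Icc, gaussianPDF,
      ← ENNReal.ofReal_mul (gaussianPDFReal_nonneg _ _ _)]
    refine ENNReal.ofReal_le_ofReal ?_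
    -- Only `2π ≥ 4` is needed to turn `2A / √(2πσ²)` into `A / σ`.
    have hs : 2 * σ ≤ √(2 * Real.pi * v) := by
      refine Real.le_sqrt_of_sq_le ?_
      rw [hv, Real.coe_toNNReal _ (by positivity)]
      nlinarith [Real.pi_gt_three, sq_nonneg σ]
    calc gaussianPDFReal 0 v 0 * (A - -A) = (√(2 * Real.pi * v))⁻¹ * (2 * A) := by
          simp [gaussianPDFReal]; left; ring
      _ ≤ (2 * σ)⁻¹ * (2 * A) := by gcongr
      _ = A / σ := by field_simp
  have hsplit : ∫⁻ y, gaussianEnvelope A v y = (∫⁻ y in Set.Iio (-A), gaussianPDF (-A) v y) +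
      (∫⁻ _ in Set.Icc (-A) A, gaussianPDF 0 v 0) + ∫⁻ y in Set.Ioi A, gaussianPDF A v y := by
    unfold gaussianEnvelope
    rw [lintegral_add_right _ ((hm A).indicator measurableSet_Ioi),
      lintegral_add_right _ (measurable_const.indicator measurableSet_Icc),
      lintegral_indicator measurableSet_Iio, lintegral_indicator measurableSet_Icc,
      lintegral_indicator measurableSet_Ioi]
  rw [hsplit, add_right_comm, ENNReal.ofReal_add zero_le_one (by positivity), ENNReal.ofReal_one]
  exact add_le_add htail hmid

/-- For signals of sup norm at most `A` in Gaussian noise, the success probabilities of any decoder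
sum to at most `(1 + A / σ) ^ n`. -/
lemma sum_gaussian_success_le {n : ℕ} {T : Type*} [MeasurableSpace T] [MeasurableSingletonClass T]
    {f : (Fin n → ℝ) → T} (hf : Measurable f) (S : Finset T) {c : T → Fin n → ℝ} {A σ : ℝ}
    (hA : 0 ≤ A) (hσ : 0 < σ) (hc : ∀ t ∈ S, ∀ i, |c t i| ≤ A) :
    ∑ t ∈ S, Measure.pi (fun _ : Fin n => gaussianReal 0 (Real.toNNReal (σ ^ 2)))
      {w | f (c t + w) = t} ≤ ENNReal.ofReal (1 + A / σ) ^ n := by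
  set v := Real.toNNReal (σ ^ 2) with hv
  have hv0 : v ≠ 0 := by
    rw [hv, Ne, Real.toNNReal_eq_zero, not_le]; positivity
  set G := (volume : Measure ℝ).withDensity (gaussianEnvelope A v) with hG
  have hGuniv : G Set.univ ≤ ENNReal.ofReal (1 + A / σ) := by
    rw [hG, withDensity_apply _ MeasurableSet.univ, Measure.restrict_univ]
    exact lintegral_gaussianEnvelope_le hA hσ
  have : IsFiniteMeasure G := ⟨hGuniv.trans_lt ENNReal.ofReal_lt_top⟩
  have hfib : ∀ t, MeasurableSet (f ⁻¹' {t}) := fun t => hf (measurableSet_singleton t)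
  -- The product of the one-dimensional envelopes dominates every signal's law, so one measure
  -- serves all `t`.
  have hle : ∀ t ∈ S, Measure.pi (fun _ : Fin n => gaussianReal 0 v) {w | f (c t + w) = t} ≤
      Measure.pi (fun _ : Fin n => G) (f ⁻¹' {t}) := fun t ht => by
    have hmap : (Measure.pi (fun _ : Fin n => gaussianReal 0 v)).map (fun w i => c t i + w i) =
        Measure.pi (fun i => gaussianReal (c t i) v) := by
      have h1 := Measure.pi_map_pi (μ := fun _ : Fin n => gaussianReal 0 v)
        (f := fun i x => c t i + x)
        (hμ := fun i => by rw [gaussianReal_map_const_add]; infer_instance)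
        (fun i => (measurable_const_add (c t i)).aemeasurable)
      simpa only [gaussianReal_map_const_add, zero_add] using h1
    have hmeas : Measurable fun (w : Fin n → ℝ) i => c t i + w i := by fun_prop
    calc Measure.pi (fun _ : Fin n => gaussianReal 0 v) {w | f (c t + w) = t}
        = Measure.pi (fun i => gaussianReal (c t i) v) (f ⁻¹' {t}) := by
          rw [← hmap, Measure.map_apply hmeas (hfib t)]; rfl
      _ ≤ _ := Measure.pi_mono
          (fun i => gaussianReal_le_withDensity_gaussianEnvelope (hc t ht i) hv0) _
  calc _ ≤ ∑ t ∈ S, Measure.pi (fun _ : Fin n => G) (f ⁻¹' {t}) := Finset.sum_le_sum hle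
    _ = Measure.pi (fun _ : Fin n => G) (⋃ t ∈ S, f ⁻¹' {t}) := by
        refine (measure_biUnion_finset (fun a _ b _ hab => ?_) fun t _ => hfib t).symm
        exact Disjoint.preimage f (Set.disjoint_singleton.2 hab)
    _ ≤ Measure.pi (fun _ : Fin n => G) Set.univ := measure_mono (Set.subset_univ _)
    _ = G Set.univ ^ n := by simp [Measure.pi_univ]
    _ ≤ _ := by gcongr

/-! ### Number of candidates against the noise threshold. -/

lemma exists_finset_admissible {p Q k : ℕ} {R : ℝ} (hQ : 0 < Q) (hk : (Q : ℝ) * R = k) :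
    ∃ S : Finset (Fin p → ℝ), S.card = (2 * k + 1) ^ p ∧ ∀ β ∈ S, β ∈ admissible p Q R := by
  have hQ' : (0 : ℝ) < Q := by exact_mod_cast hQ
  set E : Finset ℝ := (Finset.Icc (-(k : ℤ)) k).image fun m : ℤ => (m : ℝ) / Q with hE
  have hcard : E.card = 2 * k + 1 := by
    rw [hE, Finset.card_image_of_injective, Int.card_Icc]
    · omega
    · intro a b hab
      have := (div_left_inj' hQ'.ne').1 hab
      exact_mod_cast this
  refine ⟨Fintype.piFinset fun _ => E, by simp [hcard], fun β hβ => ?_⟩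
  have key : ∀ i, ∃ m : ℤ, (-(k : ℤ) ≤ m ∧ m ≤ k) ∧ (m : ℝ) / Q = β i := fun i => by
    simpa [hE] using Fintype.mem_piFinset.1 hβ i
  refine ⟨fun i => ?_, fun i => ?_⟩
  · obtain ⟨m, -, h⟩ := key i
    exact ⟨m, h.symm⟩
  · obtain ⟨m, ⟨h1, h2⟩, h⟩ := key i
    have h1' : -(k : ℝ) ≤ m := by exact_mod_cast h1
    have h2' : (m : ℝ) ≤ k := by exact_mod_cast h2
    rw [← h, Set.mem_Icc, le_div_iff₀ hQ', div_le_iff₀ hQ']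
    constructor <;> nlinarith

/-- With `a = (2k+1)^(2p/n)` and `t = √(a-1)`, one has `√a^n = (2k+1)^p`, and the threshold gives
`A/σ ≤ Kt/(n²p)`. -/
lemma one_add_pow_le_half {n p k Q : ℕ} {R K σ : ℝ} (hn : 0 < n) (hp : 0 < p) (hk : 0 < k)
    (hQR : (Q : ℝ) * R = k) (hR : 0 < R) (hK : 0 < K) (hpK : 16 * K ≤ p)
    (hσ : noiseThreshold n p Q R < σ) :
    0 < σ ∧ (1 + R * p * (n * p * K) / σ) ^ n ≤ (2 * (k : ℝ) + 1) ^ p / 2 := by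
  have hn' : (1 : ℝ) ≤ n := by exact_mod_cast hn
  have hp' : (1 : ℝ) ≤ p := by exact_mod_cast hp
  have hk' : (1 : ℝ) ≤ k := by exact_mod_cast hk
  set a : ℝ := (2 : ℝ) ^ (2 * (p : ℝ) * Real.logb 2 (2 * (Q : ℝ) * R + 1) / (n : ℝ)) with ha
  have hb : (0 : ℝ) < 2 * k + 1 := by positivity
  have ha' : a = (2 * (k : ℝ) + 1) ^ (2 * (p : ℝ) / n) := by
    rw [ha, mul_assoc 2 (Q : ℝ), hQR, mul_div_right_comm, mul_comm, Real.rpow_mul (by norm_num),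
      Real.rpow_logb (by norm_num) (by norm_num) hb]
  have ha1 : 1 < a := by
    rw [ha']; exact Real.one_lt_rpow (by linarith) (by positivity)
  set t := √(a - 1) with ht
  have ht0 : 0 < t := Real.sqrt_pos.2 (by linarith)
  have hpow : √a ^ n = (2 * (k : ℝ) + 1) ^ p := by
    rw [Real.sqrt_eq_rpow, ha', ← Real.rpow_natCast, ← Real.rpow_mul hb.le, ← Real.rpow_mul hb.le,
      ← Real.rpow_natCast]
    congr 1
    field_simp
  have hthr : noiseThreshold n p Q R = R * (n * p) ^ 3 / t := by
    rw [noiseThreshold, ← ha, Real.rpow_neg (by linarith), ← Real.sqrt_eq_rpow, div_eq_mul_inv]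
  rw [hthr] at hσ
  have hσ0 : 0 < σ := lt_trans (by positivity) hσ
  refine ⟨hσ0, ?_⟩
  have hratio : R * p * (n * p * K) / σ ≤ K / (n ^ 2 * p) * t := by
    have : R * p * (n * p * K) / σ ≤ R * p * (n * p * K) / (R * (n * p) ^ 3 / t) := by gcongr
    refine this.trans_eq ?_
    field_simp
  have hta' : t ≤ √a := Real.sqrt_le_sqrt (by linarith)
  -- For `t ≥ 4`, both `1` and `A/σ` are at most `√a/4`. For `t < 4`, `n·A/σ ≤ 1/4`, and `exp (1/4)
  -- ≤ 4/3 ≤ 3/2` suffices since `2k+1 ≥ 3`.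
  rcases le_or_gt 4 t with h4 | h4
  · have hη : K / (n ^ 2 * p) ≤ 1 / 4 := by
      rw [div_le_div_iff₀ (by positivity) (by norm_num)]
      nlinarith [mul_le_mul (one_le_pow₀ hn' : (1 : ℝ) ≤ n ^ 2) le_rfl (by positivity : (0 : ℝ) ≤ p)
        (by positivity)]
    have h1 : 1 + R * p * (n * p * K) / σ ≤ √a / 2 := by nlinarith
    calc (1 + R * p * (n * p * K) / σ) ^ n ≤ (√a / 2) ^ n := by gcongr
      _ = √a ^ n / 2 ^ n := div_pow _ _ _
      _ ≤ √a ^ n / 2 ^ 1 := by gcongr; norm_num; exact hn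
      _ = _ := by rw [hpow, pow_one]
  · have hη : n * (R * p * (n * p * K) / σ) ≤ 1 / 4 := by
      calc n * (R * p * (n * p * K) / σ) ≤ n * (K / (n ^ 2 * p) * 4) := by
            gcongr; exact hratio.trans (by gcongr)
        _ = 4 * K / (n * p) := by field_simp
        _ ≤ 1 / 4 := by
            rw [div_le_div_iff₀ (by positivity) (by norm_num)]; nlinarith
    calc (1 + R * p * (n * p * K) / σ) ^ n
        ≤ Real.exp (R * p * (n * p * K) / σ) ^ n := by
          gcongr; linarith [Real.add_one_le_exp (R * p * (n * p * K) / σ)]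
      _ = Real.exp (n * (R * p * (n * p * K) / σ)) := (Real.exp_nat_mul _ _).symm
      _ ≤ Real.exp (1 / 4) := Real.exp_le_exp.2 hη
      _ ≤ 1 / (1 - 1 / 4) := Real.exp_bound_div_one_sub_of_interval (by norm_num) (by norm_num)
      _ ≤ 3 ^ 1 / 2 := by norm_num
      _ ≤ 3 ^ p / 2 := by gcongr; norm_num; exact hp
      _ ≤ _ := by gcongr; linarith

/-! ### Averaging over the random design. -/

section Design

variable {Ω : Type*} [MeasurableSpace Ω] {μ : Measure Ω} {n p : ℕ} {D : Measure ℝ} {σ : ℝ}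
  {X : Ω → Matrix (Fin n) (Fin p) ℝ} {W : Ω → Fin n → ℝ}

lemma IsGaussianDesign.aemeasurable_design (h : IsGaussianDesign μ D σ X W) : AEMeasurable X μ :=
  aemeasurable_pi_lambda X fun i => aemeasurable_pi_lambda (fun ω => X ω i)
    fun j => (h.entry_law i j).aemeasurable

lemma IsGaussianDesign.aemeasurable_noise (h : IsGaussianDesign μ D σ X W) : AEMeasurable W μ :=
  aemeasurable_pi_lambda W fun i => (h.noise_law i).aemeasurable

lemma Matrix.measurable_entry {n p : ℕ} (i : Fin n) (j : Fin p) :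
    Measurable fun x : Matrix (Fin n) (Fin p) ℝ => x i j :=
  (measurable_pi_apply j).comp (measurable_pi_apply i)

lemma measurableSet_entry_gt (n p : ℕ) (B : ℝ) :
    MeasurableSet {x : Matrix (Fin n) (Fin p) ℝ | ∃ i j, B < |x i j|} := by
  simp only [Set.ofPred_exists]
  exact MeasurableSet.iUnion fun i => MeasurableSet.iUnion fun j =>
    measurableSet_lt measurable_const (continuous_abs.measurable.comp (Matrix.measurable_entry i j))

lemma IsGaussianDesign.map_prod_eq [IsProbabilityMeasure μ] (h : IsGaussianDesign μ D σ X W) :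
    μ.map (fun ω => (X ω, W ω)) = (μ.map X).prod
      (Measure.pi fun _ : Fin n => gaussianReal 0 (Real.toNNReal (σ ^ 2))) := by
  rw [(indepFun_iff_map_prod_eq_prod_map_map h.aemeasurable_design h.aemeasurable_noise).1 h.indep]
  congr 1
  have := (iIndepFun_iff_map_fun_eq_pi_map fun i => (h.noise_law i).aemeasurable).1 h.noise_indep
  simpa only [(h.noise_law _).map_eq] using this

/-- Markov's inequality for each entry; the factor `np` in the cutoff cancels the union bound over
`np` entries. -/
lemma IsGaussianDesign.measure_entry_gt_le (h : IsGaussianDesign μ D σ X W) (hn : 0 < n)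
    (hp : 0 < p) {K : ℝ} (hK : 0 < K) :
    μ.map X {x | ∃ i j, n * p * K < |x i j|} ≤
      (∫⁻ x, ‖x‖ₑ ∂D) / ENNReal.ofReal K := by
  have hn' : (0 : ℝ) < n := by exact_mod_cast hn
  have hp' : (0 : ℝ) < p := by exact_mod_cast hp
  have hB : 0 < (n : ℝ) * p * K := by positivity
  rw [Measure.map_apply_of_aemeasurable h.aemeasurable_design (measurableSet_entry_gt n p _)]
  have hentry : ∀ i j, μ {ω | n * p * K < |X ω i j|} ≤
      (∫⁻ x, ‖x‖ₑ ∂D) / ENNReal.ofReal (n * p * K) := fun i j => by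
    rw [(h.entry_law i j).measure_eq (p := fun x => n * p * K < |x|)
      (measurableSet_lt measurable_const continuous_abs.measurable)]
    refine le_trans (measure_mono fun x (hx : n * p * K < |x|) => ?_)
      (meas_ge_le_lintegral_div (f := fun x : ℝ => ‖x‖ₑ) (by fun_prop)
        (by simpa using hB) ENNReal.ofReal_ne_top)
    rw [Set.mem_ofPred_eq, ← ofReal_norm, Real.norm_eq_abs]
    exact ENNReal.ofReal_le_ofReal hx.le
  have hsub : X ⁻¹' {x | ∃ i j, n * p * K < |x i j|} =
      ⋃ ij : Fin n × Fin p, {ω | n * p * K < |X ω ij.1 ij.2|} := by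
    ext ω; simp
  rw [hsub]
  calc μ (⋃ ij : Fin n × Fin p, {ω | n * p * K < |X ω ij.1 ij.2|})
      ≤ ∑ ij : Fin n × Fin p, μ {ω | n * p * K < |X ω ij.1 ij.2|} :=
        measure_iUnion_fintype_le _ _
    _ ≤ ∑ _ : Fin n × Fin p, (∫⁻ x, ‖x‖ₑ ∂D) / ENNReal.ofReal (n * p * K) :=
        Finset.sum_le_sum fun ij _ => hentry ij.1 ij.2
    _ = (n * p : ℝ≥0∞) * ((∫⁻ x, ‖x‖ₑ ∂D) / ((n * p : ℝ≥0∞) * ENNReal.ofReal K)) := by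
        rw [ENNReal.ofReal_mul (by positivity), ENNReal.ofReal_mul (by positivity)]
        simp
    _ = (∫⁻ x, ‖x‖ₑ ∂D) / ENNReal.ofReal K := by
        rw [← mul_div_assoc, ENNReal.mul_div_mul_left]
        · simp [hn.ne', hp.ne']
        · exact ENNReal.mul_ne_top (ENNReal.natCast_ne_top _) (ENNReal.natCast_ne_top _)

lemma abs_mulVec_le {x : Matrix (Fin n) (Fin p) ℝ} {β : Fin p → ℝ} {B R : ℝ} (hB : 0 ≤ B)
    (hx : ∀ i j, |x i j| ≤ B) (hβ : ∀ j, |β j| ≤ R) (i : Fin n) : |(x *ᵥ β) i| ≤ R * p * B := by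
  calc |(x *ᵥ β) i| = |∑ j, x i j * β j| := rfl
    _ ≤ ∑ j, |x i j * β j| := Finset.abs_sum_le_sum_abs _ _
    _ ≤ ∑ _ : Fin p, B * R := Finset.sum_le_sum fun j _ => by
        rw [abs_mul]; exact mul_le_mul (hx i j) (hβ j) (abs_nonneg _) hB
    _ = R * p * B := by simp; ring

/-- The success probabilities of any estimator on a finite set `S` of vectors in `[-R, R]^p` sum to
at most the probability that an entry of the design exceeds `B` in absolute value, times `#S`, plus
a power that depends on the signal to noise ratio only. -/
lemma IsGaussianDesign.sum_success_le [IsProbabilityMeasure μ] (h : IsGaussianDesign μ D σ X W)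
    {f : (Fin n → ℝ) × Matrix (Fin n) (Fin p) ℝ → Fin p → ℝ} (hf : Measurable f)
    {R B : ℝ} (hR : 0 ≤ R) (hB : 0 ≤ B) (hσ : 0 < σ)
    (S : Finset (Fin p → ℝ)) (hS : ∀ β ∈ S, ∀ j, |β j| ≤ R) :
    ∑ β ∈ S, μ {ω | f (X ω *ᵥ β + W ω, X ω) = β} ≤
      S.card * μ.map X {x | ∃ i j, B < |x i j|} + ENNReal.ofReal (1 + R * p * B / σ) ^ n := by
  set P := Measure.pi fun _ : Fin n => gaussianReal 0 (Real.toNNReal (σ ^ 2))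
  have hXm := h.aemeasurable_design
  have : IsProbabilityMeasure (μ.map X) := Measure.isProbabilityMeasure_map hXm
  set bad := {x : Matrix (Fin n) (Fin p) ℝ | ∃ i j, B < |x i j|}
  have hbad : MeasurableSet bad := measurableSet_entry_gt n p B
  have hE : ∀ β : Fin p → ℝ, MeasurableSet
      {d : Matrix (Fin n) (Fin p) ℝ × (Fin n → ℝ) | f (d.1 *ᵥ β + d.2, d.1) = β} := fun β => by
    have hent : ∀ i j, Measurable fun d : Matrix (Fin n) (Fin p) ℝ × (Fin n → ℝ) => d.1 i j :=
      fun i j => (Matrix.measurable_entry i j).comp measurable_fst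
    have hY : Measurable fun d : Matrix (Fin n) (Fin p) ℝ × (Fin n → ℝ) => d.1 *ᵥ β + d.2 := by
      refine measurable_pi_lambda _ fun i => ?_
      have hsum : Measurable fun d : Matrix (Fin n) (Fin p) ℝ × (Fin n → ℝ) =>
          ∑ j, d.1 i j * β j := Finset.measurable_fun_sum _ fun j _ => (hent i j).mul_const (β j)
      exact hsum.add ((measurable_pi_apply i).comp measurable_snd)
    exact hf.comp (hY.prodMk measurable_fst) (measurableSet_singleton β)
  have hlaw : ∀ β : Fin p → ℝ, μ {ω | f (X ω *ᵥ β + W ω, X ω) = β} =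
      ∫⁻ x, P {w | f (x *ᵥ β + w, x) = β} ∂(μ.map X) := fun β => by
    have h1 := Measure.map_apply_of_aemeasurable (hXm.prodMk h.aemeasurable_noise) (hE β)
    rw [h.map_prod_eq, Measure.prod_apply (hE β)] at h1
    exact h1.symm
  -- On bad designs each success probability is bounded by `1`; on good ones the signal is at most
  -- `RpB`.
  have hpt : ∀ x, ∑ β ∈ S, P {w | f (x *ᵥ β + w, x) = β} ≤
      bad.indicator (fun _ => (S.card : ℝ≥0∞)) x + ENNReal.ofReal (1 + R * p * B / σ) ^ n :=
    fun x => by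
    by_cases hx : x ∈ bad
    · rw [Set.indicator_of_mem hx]
      refine le_add_right ?_
      calc ∑ β ∈ S, P {w | f (x *ᵥ β + w, x) = β} ≤ ∑ _ ∈ S, 1 :=
            Finset.sum_le_sum fun _ _ => prob_le_one
        _ = _ := by simp
    · refine le_add_left (sum_gaussian_success_le (f := fun y => f (y, x))
        (hf.comp measurable_prodMk_right) S (c := fun β => x *ᵥ β) (by positivity) hσ
        fun β hβ i => abs_mulVec_le hB (fun i j => ?_) (hS β hβ) i)
      by_contra hij
      exact hx ⟨i, j, not_le.1 hij⟩
  calc ∑ β ∈ S, μ {ω | f (X ω *ᵥ β + W ω, X ω) = β}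
      = ∫⁻ x, ∑ β ∈ S, P {w | f (x *ᵥ β + w, x) = β} ∂(μ.map X) := by
        refine (Finset.sum_congr rfl fun β _ => hlaw β).trans (lintegral_finsetSum S ?_).symm
        exact fun β _ => measurable_measure_prodMk_left (hE β)
    _ ≤ ∫⁻ x, bad.indicator (fun _ => (S.card : ℝ≥0∞)) x +
          ENNReal.ofReal (1 + R * p * B / σ) ^ n ∂(μ.map X) := lintegral_mono hpt
    _ = _ := by
        rw [lintegral_add_right _ measurable_const, lintegral_indicator_const hbad]
        simp

lemma IsGaussianDesign.exists_success_le [IsProbabilityMeasure μ] (h : IsGaussianDesign μ D σ X W)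
    {f : (Fin n → ℝ) × Matrix (Fin n) (Fin p) ℝ → Fin p → ℝ} (hf : Measurable f) {Q k : ℕ}
    {R K : ℝ} (hn : 0 < n) (hp : 0 < p) (hQ : 0 < Q) (hR : 0 < R) (hk : (Q : ℝ) * R = k)
    (hK : 0 < K) (hDK : (∫⁻ x, ‖x‖ₑ ∂D) / ENNReal.ofReal K ≤ 4⁻¹) (hpK : 16 * K ≤ p)
    (hσ : noiseThreshold n p Q R < σ) :
    ∃ β ∈ admissible p Q R, μ {ω | f (X ω *ᵥ β + W ω, X ω) = β} ≤ 4⁻¹ + 2⁻¹ := by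
  have hk0 : 0 < k := by
    have : (0 : ℝ) < Q * R := by positivity
    rw [hk] at this
    exact_mod_cast this
  obtain ⟨hσ0, hpow⟩ := one_add_pow_le_half hn hp hk0 hk hR hK hpK hσ
  obtain ⟨S, hScard, hS⟩ := exists_finset_admissible (p := p) hQ hk
  have hne : S.Nonempty := Finset.card_pos.1 (by rw [hScard]; positivity)
  have hsum := h.sum_success_le hf hR.le (B := n * p * K) (by positivity) hσ0 S
    fun β hβ j => abs_le.2 ((hS β hβ).2 j)
  have hpow' : ENNReal.ofReal (1 + R * p * (n * p * K) / σ) ^ n ≤ S.card * 2⁻¹ := by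
    rw [← ENNReal.ofReal_pow (by positivity)]
    refine (ENNReal.ofReal_le_ofReal hpow).trans_eq ?_
    rw [ENNReal.ofReal_div_of_pos two_pos, hScard, div_eq_mul_inv]
    congr 1
    · rw [← ENNReal.ofReal_natCast]
      push_cast
      rfl
    · simp
  have htotal : ∑ β ∈ S, μ {ω | f (X ω *ᵥ β + W ω, X ω) = β} ≤ ∑ _ ∈ S, (4⁻¹ + 2⁻¹ : ℝ≥0∞) := by
    rw [Finset.sum_const, nsmul_eq_mul, mul_add]
    refine hsum.trans (add_le_add ?_ hpow')
    gcongr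
    exact (h.measure_entry_gt_le hn hp hK).trans hDK
  obtain ⟨β, hβ, hle⟩ := ENNReal.exists_le_of_sum_le hne htotal
  exact ⟨β, hS β hβ, hle⟩

end Design

/-! ### Choice of constants and passage to the limit. -/

theorem mainTheorem5
    -- the fixed continuous entry law, with finite mean
    (D : Measure ℝ) [IsProbabilityMeasure D] (hD_cont : ∀ x : ℝ, D {x} = 0)
    (hD_mean : Integrable (fun x : ℝ => x) D)
    -- the parameters, arbitrary functions of `p`
    (n Q : ℕ → ℕ) (R σ : ℕ → ℝ)
    (hn : ∀ p, 0 < p → 0 < n p) (hQ : ∀ p, 0 < p → 0 < Q p) (hR : ∀ p, 0 < p → 0 < R p)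
    (hQR : ∀ p, 0 < p → ∃ k : ℕ, (Q p : ℝ) * R p = (k : ℝ))
    (hσ : ∀ p, 0 < p → noiseThreshold (n p) p (Q p) (R p) < σ p)
    -- the design matrix and the noise vector
    {Ω : ℕ → Type*} [∀ p, MeasurableSpace (Ω p)]
    (μ : ∀ p, Measure (Ω p)) [∀ p, IsProbabilityMeasure (μ p)]
    (X : ∀ p, Ω p → Matrix (Fin (n p)) (Fin p) ℝ) (W : ∀ p, Ω p → Fin (n p) → ℝ)
    (hXW : ∀ p, 0 < p → IsGaussianDesign (μ p) D (σ p) (X p) (W p))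
    -- the recovery mechanism
    (est : Estimator) (hest : est.IsMeasurable) :
    ∃ β : ∀ p, Fin p → ℝ,
      (∀ p, 0 < p → β p ∈ admissible p (Q p) (R p)) ∧
      limsup (fun p => μ p {ω |
          est (n p) p (X p ω *ᵥ β p + W p ω) (X p ω) (Q p) (R p) (σ p) = β p}) atTop < 1 := by
  have hfin : ∫⁻ x : ℝ, ‖x‖ₑ ∂D ≠ ⊤ := hD_mean.hasFiniteIntegral.ne
  set m := (∫⁻ x : ℝ, ‖x‖ₑ ∂D).toReal with hm
  have hm0 : 0 ≤ m := ENNReal.toReal_nonneg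
  -- `K = 4m + 1` makes the Markov bound `m/K` at most `1/4`, and the `+ 1` makes `K > 0` immediate.
  have hDK : (∫⁻ x : ℝ, ‖x‖ₑ ∂D) / ENNReal.ofReal (4 * m + 1) ≤ 4⁻¹ := by
    refine ENNReal.div_le_of_le_mul ?_
    rw [← ENNReal.ofReal_toReal hfin, ← hm]
    have h4 : (4⁻¹ : ℝ≥0∞) = ENNReal.ofReal 4⁻¹ := by
      rw [ENNReal.ofReal_inv_of_pos (by norm_num)]; simp
    rw [h4, ← ENNReal.ofReal_mul (by norm_num)]
    exact ENNReal.ofReal_le_ofReal (by linarith)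
  have key : ∀ p, ∃ β : Fin p → ℝ, (0 < p → β ∈ admissible p (Q p) (R p)) ∧
      (0 < p → 16 * (4 * m + 1) ≤ p → μ p {ω |
        est (n p) p (X p ω *ᵥ β + W p ω) (X p ω) (Q p) (R p) (σ p) = β} ≤ 4⁻¹ + 2⁻¹) := by
    intro p
    rcases Nat.eq_zero_or_pos p with h0 | hp
    · exact ⟨0, fun h => absurd h (by omega), fun h => absurd h (by omega)⟩
    obtain ⟨k, hk⟩ := hQR p hp
    by_cases hpK : 16 * (4 * m + 1) ≤ p
    · obtain ⟨β, hβ, hle⟩ := (hXW p hp).exists_success_le (hest (n p) p (Q p) (R p) (σ p))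
        (hn p hp) hp (hQ p hp) (hR p hp) hk (by positivity) hDK hpK (hσ p hp)
      exact ⟨β, fun _ => hβ, fun _ _ => hle⟩
    -- For small `p` any admissible vector will do, as the limsup ignores it.
    · exact ⟨0, fun _ => ⟨fun i => ⟨0, by simp⟩, fun i => by simpa using (hR p hp).le⟩,
        fun _ h => absurd h hpK⟩
  choose β hβ hle using key
  refine ⟨β, hβ, ?_⟩
  have hev : ∀ᶠ p : ℕ in atTop, μ p {ω |
      est (n p) p (X p ω *ᵥ β p + W p ω) (X p ω) (Q p) (R p) (σ p) = β p} ≤ 4⁻¹ + 2⁻¹ := by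
    filter_upwards [eventually_gt_atTop 0, eventually_ge_atTop ⌈16 * (4 * m + 1)⌉₊] with p h1 h2
    exact hle p h1 ((Nat.le_ceil _).trans (by exact_mod_cast h2))
  refine (limsup_le_of_le (by isBoundedDefault) hev).trans_lt ?_
  rw [← ENNReal.inv_two_add_inv_two]
  refine ENNReal.add_lt_add_right (by simp) ?_
  exact ENNReal.inv_lt_inv.2 (by norm_num)
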